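/- **Setting.** Words are over the binary alphabet $\{1,2\}$; $\overline a$ denotes the symbol other than $a$. The Parikh vector $P(u)$ of a word $u$ is the pair (number of $1$s in $u$, number of $2$s in $u$). For a word $w$ of length $n$ and positions $i<j$ with $w[i]\ne w[j]$, the 2-swap $w\circ(i,j)$ is the word obtained from $w$ by exchanging the symbols at positions $i$ and $j$. The configuration graph $G(P)$ has as vertices the words with Parikh vector $P$, two words being adjacent if one is a 2-swap of the other. A Hamiltonian path is a path that visits every vertex exactly once (if $G(P)$ has a single vertex, the path without edges). **Algorithm.** $\textsc{HamiltonianEnumeration}$ keeps the current word $w$ (of length $n$) in an array, together with two balanced binary search trees (AVL trees) $T_1,T_2$, where $T_a$ stores the positions of the symbol $a$ in $w$. The preprocessing builds $T_1,T_2$ from the input word by successive insertions; then the procedure below is called with $P$ the Parikh vector of the input word and $last\_state$ the null pointer. "Perform $(i,j)$" means: output $(i,j)$, update $T_1,T_2$ by removing and inserting $i$ and $j$, and replace $w$ by $w\circ(i,j)$. $\textsc{HamiltonianEnumeration}(P=(P_1,P_2),\,last\_state)$: 1. If $P_1=0$ or $P_2=0$, return to $last\_state$. 2. Else, if $P=(1,1)$,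 perform $(n-1,n)$ and return to $last\_state$. 3. Else let $m=n-(P_1+P_2-1)$, $R_1=\max T_1$, $R_2=\max T_2$. - For $i=\min(R_1,R_2),\min(R_1,R_2)-1,\dots,m+1$: let $j$ be the smallest element of $T_{\overline{w[i]}}$ larger than $i$, perform $(i,j)$, let $P'$ be the Parikh vector of $w[i+1]\cdots w[n]$, and call $\textsc{HamiltonianEnumeration}(P',\text{current state})$. - Finally, let $j$ be the smallest element of $T_{\overline{w[m]}}$ larger than $m$, perform $(m,j)$, let $P'=P-P(w[m])$ (with $w[m]$ the new symbol), and call $\textsc{HamiltonianEnumeration}(P',last\_state)$. "Return to" a state resumes the loop of that activation record with the next value of $i$; returning to the null pointer ends the computation. The Parikh vectors $P'$ are maintained incrementally. Time is measured in the unit-cost model: following a pointer, allocating a record, accessing an array cell, and comparing or combining integers arithmetically take constant time each. **Theorem.** There is an absolute constant $C$ such that the following holds. Let $P=(P_1,P_2)\in\mathbb N_0^2$ with $P_1+P_2=n$, and let $w$ be a word with Parikh vector $P$. Then $\textsc{HamiltonianEnumeration}$, run on $w$, terminates, and the sequence of pairs that it outputs is the sequence of 2-swaps along a Hamiltonian path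 of $G(P)$ starting at $w$. Moreover, if $n\ge 2$, the preprocessing takes at most $C\,n\log n$ time, and at most $C\log n$ time passes between any two consecutive outputs, as well as between the end of the preprocessing and the first output, and between the last output and termination (between the end of the preprocessing and termination, if there is no output). -/

import Mathlib

namespace TwoSwap

/-! ### Words, 2-swaps and the configuration graph

Symbols `1, …, σ` are represented by the elements of `Fin σ`, and the positions of a word of
length `n` are numbered `0, …, n - 1`. -/

/-- Words of length `n` over an alphabet of `σ` symbols. -/
abbrev Word (σ n : ℕ) := Fin n → Fin σ

/-- The Parikh vector: `parikh w a` is the number of occurrences of the symbol `a` in `w`. -/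
def parikh {σ n : ℕ} (w : Word σ n) : Fin σ → ℕ :=
  fun a => (Finset.univ.filter fun j => w j = a).card

/-- The word obtained from `w` by exchanging the symbols at the positions `i` and `j`. -/
def swapAt {σ n : ℕ} (w : Word σ n) (i j : Fin n) : Word σ n :=
  fun k => w (Equiv.swap i j k)

/-- `u` is the 2-swap of `w` by `(i, j)`, where `i < j` and the two symbols differ. -/
def IsTwoSwap {σ n : ℕ} (w : Word σ n) (i j : Fin n) (u : Word σ n) : Prop :=
  i < j ∧ w i ≠ w j ∧ u = swapAt w i j

theorem IsTwoSwap.symm {σ n : ℕ} {w u : Word σ n} {i j : Fin n} (h : IsTwoSwap w i j u) :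
    IsTwoSwap u i j w := by
  obtain ⟨hij, hne, rfl⟩ := h
  refine ⟨hij, ?_, ?_⟩
  · simpa [swapAt] using hne.symm
  · funext k
    simp [swapAt]

/-- The words of length `n` with Parikh vector `P`. -/
abbrev ParikhWord {σ : ℕ} (n : ℕ) (P : Fin σ → ℕ) := {w : Word σ n // parikh w = P}

/-- The configuration graph `G(P)`: words with Parikh vector `P`, adjacent when one is a 2-swap
of the other. -/
def configGraph {σ : ℕ} (n : ℕ) (P : Fin σ → ℕ) : SimpleGraph (ParikhWord n P) where
  Adj w u := ∃ i j : Fin n, IsTwoSwap w.1 i j u.1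
  symm := ⟨fun _ _ ⟨i, j, h⟩ => ⟨i, j, h.symm⟩⟩
  loopless := ⟨fun w ⟨i, j, _, hne, h⟩ => hne (by
    have := congrFun h i
    simpa [swapAt] using this)⟩

/-- The list `out` of pairs of positions is the list of edges of a Hamiltonian path of the
configuration graph that starts at `w`: the `t`-th pair is the 2-swap that leads from the `t`-th to
the `(t + 1)`-st vertex of the path. -/
def IsHamiltonianPathFrom {σ n : ℕ} {P : Fin σ → ℕ} (w : ParikhWord n P)
    (out : List (ℕ × ℕ)) : Prop :=
  ∃ (u : ParikhWord n P) (p : (configGraph n P).Walk w u), p.IsHamiltonian ∧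
    List.Forall₂ (fun (d : (configGraph n P).Dart) (s : ℕ × ℕ) =>
      ∃ i j : Fin n, s = ((i : ℕ), (j : ℕ)) ∧ IsTwoSwap d.fst.1 i j d.snd.1) p.darts out

/-! ### Counting steps

Unit cost model: following a pointer, allocating a record, reading or writing an array cell, and
comparing or combining integers arithmetically (all of them are between `0` and `n`) each take
constant time. A tree is given by a pointer to its root.
One step is charged for every function call and for every basic block of the programs below, each of
which performs, apart from the calls in it, a bounded number of such operations. -/

/-- A value together with the number of steps taken to compute it. -/
structure Timed (α : Type) where
  val : α
  time : ℕ

instance : Monad Timed where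
  pure a := ⟨a, 0⟩
  bind x f := ⟨(f x.val).val, x.time + (f x.val).time⟩

/-- One step. -/
def tick : Timed Unit := ⟨(), 1⟩

/-! ### Balanced binary search trees (AVL trees) -/

/-- Binary trees whose nodes carry a key and the height of the subtree at the node. -/
inductive Tree where
  | nil : Tree
  | node (l : Tree) (key : ℕ) (ht : ℕ) (r : Tree) : Tree

namespace Tree

/-- The height stored at the root. -/
def height : Tree → ℕ
  | nil => 0
  | node _ _ h _ => h

/-- Allocate a node. -/
def mk (l : Tree) (k : ℕ) (r : Tree) : Timed Tree := do
  tick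
  return node l k (max l.height r.height + 1) r

/-- Allocate a node with subtrees `l`, `r`, rotating if `l` is too high. -/
def balL (l : Tree) (k : ℕ) (r : Tree) : Timed Tree := do
  tick
  if l.height = r.height + 2 then
    match l with
    | nil => mk l k r
    | node a x _ b =>
      if b.height ≤ a.height then
        let r' ← mk b k r
        mk a x r'
      else
        match b with
        | nil => mk l k r
        | node b₁ y _ b₂ =>
          let l' ← mk a x b₁
          let r' ← mk b₂ k r
          mk l' y r'
  else mk l k r

/-- Allocate a node with subtrees `l`, `r`, rotating if `r` is too high. -/
def balR (l : Tree) (k : ℕ) (r : Tree) : Timed Tree := do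
  tick
  if r.height = l.height + 2 then
    match r with
    | nil => mk l k r
    | node b x _ c =>
      if b.height ≤ c.height then
        let l' ← mk l k b
        mk l' x c
      else
        match b with
        | nil => mk l k r
        | node b₁ y _ b₂ =>
          let l' ← mk l k b₁
          let r' ← mk b₂ x c
          mk l' y r'
  else mk l k r

/-- Insert a key. -/
def insert (x : ℕ) : Tree → Timed Tree
  | nil => do
    tick
    mk nil x nil
  | node l k h r => do
    tick
    if x < k then
      let l' ← insert x l
      balL l' k r
    else if k < x then
      let r' ← insert x r
      balR l k r'
    else return node l k h r

/-- Remove the largest key of the tree with root `k` and subtrees `l`, `r`; return the remaining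
tree and the removed key. -/
def splitMax (l : Tree) (k : ℕ) : Tree → Timed (Tree × ℕ)
  | nil => do
    tick
    return (l, k)
  | node rl rk _ rr => do
    tick
    let p ← splitMax rl rk rr
    let t ← balL l k p.1
    return (t, p.2)

/-- Remove a key. -/
def remove (x : ℕ) : Tree → Timed Tree
  | nil => do
    tick
    return nil
  | node l k _ r => do
    tick
    if x < k then
      let l' ← remove x l
      balR l' k r
    else if k < x then
      let r' ← remove x r
      balL l k r'
    else
      match l with
      | nil => return r
      | node ll lk _ lr =>
        let p ← splitMax ll lk lr
        balR p.1 p.2 r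

/-- The largest key (`d` if the tree is empty). -/
def findMax (d : ℕ) : Tree → Timed ℕ
  | nil => do
    tick
    return d
  | node _ k _ r => do
    tick
    findMax k r

/-- The smallest key larger than `x` (`d` if there is none). -/
def findGT (x d : ℕ) : Tree → Timed ℕ
  | nil => do
    tick
    return d
  | node l k _ r => do
    tick
    if x < k then findGT x k l else findGT x d r

end Tree

/-! ### The algorithm -/

/-- The other symbol of the binary alphabet. -/
def other (a : Fin 2) : Fin 2 := Fin.rev a

/-- The Parikh vector of the one-letter word `a`. -/
def unit (a : Fin 2) : Fin 2 → ℕ := Pi.single a 1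

/-- The global variables of the algorithm (the array with the current word, the trees `T₁`, `T₂`
with the positions of the two symbols), together with what is observed of the run: the number of
steps taken so far, and the list of the pairs output so far, each with the time of its output. -/
structure Machine where
  word : ℕ → Fin 2
  tree : Fin 2 → Tree
  clock : ℕ
  log : List ((ℕ × ℕ) × ℕ)

abbrev Exec := StateM Machine

/-- One step. -/
def charge : Exec Unit :=
  modify fun M => { M with clock := M.clock + 1 }

/-- Run a subroutine, charging its running time. -/
def runTimed {α : Type} (t : Timed α) : Exec α := do
  modify fun M => { M with clock := M.clock + t.time }
  return t.val

def readCell (k : ℕ) : Exec (Fin 2) := do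
  charge
  return (← get).word k

def writeCell (k : ℕ) (a : Fin 2) : Exec Unit := do
  charge
  modify fun M => { M with word := Function.update M.word k a }

/-- Output the pair `(i, j)`. -/
def output (i j : ℕ) : Exec Unit := do
  charge
  modify fun M => { M with log := M.log ++ [((i, j), M.clock)] }

/-- `Remove(T_a, x)`. -/
def removeFrom (a : Fin 2) (x : ℕ) : Exec Unit := do
  let t ← runTimed (((← get).tree a).remove x)
  modify fun M => { M with tree := Function.update M.tree a t }

/-- `Insert(T_a, x)`. -/
def insertInto (a : Fin 2) (x : ℕ) : Exec Unit := do
  let t ← runTimed (((← get).tree a).insert x)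
  modify fun M => { M with tree := Function.update M.tree a t }

/-- Update the trees and the word for the swap `(i, j)`. -/
def applySwap (i j : ℕ) : Exec Unit := do
  let a ← readCell i
  let b ← readCell j
  removeFrom a i
  insertInto a j
  removeFrom b j
  insertInto b i
  writeCell i b
  writeCell j a

/-- Let `j > i` be the smallest position whose symbol differs from that at `i`; output and perform
the swap `(i, j)`. Returns the new symbol at position `i`. -/
def swapNext (i : ℕ) : Exec (Fin 2) := do
  let a ← readCell i
  let j ← runTimed (((← get).tree (other a)).findGT i i)
  output i j
  applySwap i j
  return other a

/-- The activation record of a call that waits for the return from a call made in its loop: its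
argument `P`, the loop variable `i`, and the Parikh vector `Q` of the suffix of the current word
that starts at position `i`. -/
structure Frame where
  P : Fin 2 → ℕ
  i : ℕ
  Q : Fin 2 → ℕ

/-- A pointer into the stack of activation records. The record pointed to is the first one in the
list, and the rest of the list is the pointer `last_state` that is part of this record. -/
abbrev Pointer := List Frame

/-- The points of the program at which the run is observed. -/
inductive Control where
  /-- beginning of the call with arguments `P` and `last_state` -/
  | call (P : Fin 2 → ℕ) (last_state : Pointer) : Control
  /-- head of the loop in the call with arguments `P` and `last_state`, with loop variable `i` and
  the Parikh vector `Q` of the suffix that starts at position `i` -/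
  | loop (P : Fin 2 → ℕ) (i : ℕ) (Q : Fin 2 → ℕ) (last_state : Pointer) : Control
  | halted : Control

/-- `Return To` a state: its loop goes on with the next value of the loop variable. The null
pointer ends the computation. -/
def returnTo : Pointer → Exec Control
  | [] => do
    charge
    return .halted
  | f :: last_state => do
    charge
    let a ← readCell (f.i - 1)
    return .loop f.P (f.i - 1) (f.Q + unit a) last_state

/-- The body of `HamiltonianEnumeration(P, last_state)` on words of length `n`. The argument `P` is
the Parikh vector of the suffix of the current word that starts at position `n - (P 0 + P 1)`. -/
def step (n : ℕ) : Control → Exec Control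
  | .call P last_state => do
    charge
    if P 0 = 0 ∨ P 1 = 0 then
      returnTo last_state
    else if P 0 = 1 ∧ P 1 = 1 then
      output (n - 2) (n - 1)
      applySwap (n - 2) (n - 1)
      returnTo last_state
    else
      let R₁ ← runTimed (((← get).tree 0).findMax 0)
      let R₂ ← runTimed (((← get).tree 1).findMax 0)
      let i := min R₁ R₂
      -- the suffix that starts at `i` is one symbol `a` followed by copies of the other symbol
      let a ← readCell i
      return .loop P i (unit a + (n - 1 - i) • unit (other a)) last_state
  | .loop P i Q last_state => do
    charge
    let m := n - (P 0 + P 1)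
    if m < i then
      let c ← swapNext i
      return .call (Q - unit c) (⟨P, i, Q⟩ :: last_state)
    else
      let c ← swapNext m
      -- the call in tail position skips over the current state
      return .call (P - unit c) last_state
  | .halted => return .halted

/-- Preprocessing: build the trees of the positions `0, …, k - 1` by successive insertions. -/
def buildTrees (word : ℕ → Fin 2) : ℕ → Timed (Fin 2 → Tree)
  | 0 => do
    tick
    return fun _ => .nil
  | k + 1 => do
    let T ← buildTrees word k
    tick
    let t ← (T (word k)).insert k
    return Function.update T (word k) t

/-- The array with the input word. -/
def arrayOf {n : ℕ} (w : Word 2 n) : ℕ → Fin 2 :=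
  fun k => if h : k < n then w ⟨k, h⟩ else 0

/-- The number of steps of the preprocessing. -/
def preprocessingTime {n : ℕ} (w : Word 2 n) : ℕ := (buildTrees (arrayOf w) n).time

/-- The state after the preprocessing, when the procedure is called with the Parikh vector of the
input word and the null pointer. -/
def start {n : ℕ} (w : Word 2 n) : Control × Machine :=
  (.call (parikh w) [],
    { word := arrayOf w
      tree := (buildTrees (arrayOf w) n).val
      clock := preprocessingTime w
      log := [] })

/-- The state after `k` iterations of `step`. -/
def stateAfter {n : ℕ} (w : Word 2 n) (k : ℕ) : Control × Machine :=
  (fun s : Control × Machine => (step n s.1).run s.2)^[k] (start w)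

/-- The algorithm, run on the input word `w`, halts with the final machine state `M`. -/
def HaltsWith {n : ℕ} (w : Word 2 n) (M : Machine) : Prop :=
  ∃ k, stateAfter w k = (.halted, M)

/-- The pairs output by a run. -/
def Machine.outputs (M : Machine) : List (ℕ × ℕ) := M.log.map Prod.fst

/-- The times of the outputs of a run. -/
def Machine.outputTimes (M : Machine) : List ℕ := M.log.map Prod.snd

/-- At most `D` steps pass between the end of the preprocessing (at time `t₀`) and the first
output, between any two consecutive outputs, and between the last output and the end of the run
(between the end of the preprocessing and the end of the run, if there is no output). -/
def DelayAtMost (M : Machine) (t₀ : ℕ) (D : ℝ) : Prop :=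
  List.IsChain (fun s t : ℕ => (t : ℝ) - (s : ℝ) ≤ D) (t₀ :: (M.outputTimes ++ [M.clock]))

end TwoSwap

/-!
The procedure enumerates the rearrangements of a suffix of the current word by induction on the
length of the suffix. Let `u` be the word at the beginning of a call on the suffix that starts at
`s`. When its loop reaches `i`, every rearrangement of the positions `i + 1, …, n - 1` has been
visited exactly once, and the current word still agrees with `u` at `i`. The suffix from `i`
contains both symbols, so there is a 2-swap that changes the symbol at `i`. The call that follows
visits the rearrangements of the positions `i + 1, …, n - 1` of the new word, and these are
exactly the rearrangements of the positions `i, …, n - 1` of `u` that have the other symbol at `i`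
(`Enumerates.append`). At the start of the loop the suffix from `i + 1` is constant, so there is
nothing but `u` to visit (`Enumerates.nil_of_const`). The end of the loop is a call in tail
position, which returns directly to the pointer of its caller; the statement proved by induction,
`callCorrect`, therefore says that a call with pointer `ls` leads to the state obtained by
returning to `ls`.

The delay is bounded because a call either outputs at once, or enters a loop, which begins with an
output, or returns to a loop, which resumes with an output, or ends the run. Hence only boundedly
many tree operations take place between two outputs. In the proof this is expressed by a budget:
`Machine.Paced n t₀ c M` says that `c` more steps may be taken before the next output. Each output
resets the budget to `maxDelay n`, and `callCorrect` needs a budget of `4 * opTime n + 10` at the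
beginning of the call and guarantees one of `opTime n + 5` at its end.

The trees remain AVL search trees, so that `2 ^ h ≤ (n + 1) ^ 2` for their heights `h`
(`Tree.two_pow_height_le`), and a tree operation takes a number of steps linear in `h`.
-/

namespace TwoSwap

/-! ### Values and times of timed computations -/

namespace Timed

@[simp] theorem bind_val {α β : Type} (x : Timed α) (f : α → Timed β) :
    (x >>= f).val = (f x.val).val := rfl

@[simp] theorem bind_time {α β : Type} (x : Timed α) (f : α → Timed β) :
    (x >>= f).time = x.time + (f x.val).time := rfl

@[simp] theorem pure_val {α : Type} (a : α) : (pure a : Timed α).val = a := rfl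

@[simp] theorem pure_time {α : Type} (a : α) : (pure a : Timed α).time = 0 := rfl

@[simp] theorem tick_time : tick.time = 1 := rfl

end Timed

/-! ### AVL trees -/

namespace Tree

/-- The keys of a tree, in order. -/
def toList : Tree → List ℕ
  | nil => []
  | node l k _ r => l.toList ++ k :: r.toList

/-- The AVL condition: the stored heights are correct, and the heights of siblings differ by at
most one. -/
def IsAVL : Tree → Prop
  | nil => True
  | node l _ h r => l.IsAVL ∧ r.IsAVL ∧ h = max l.height r.height + 1 ∧
      l.height ≤ r.height + 1 ∧ r.height ≤ l.height + 1

/-- The search tree condition: the keys increase from left to right. -/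
def IsBST (t : Tree) : Prop := t.toList.Pairwise (· < ·)

@[simp] theorem toList_nil : nil.toList = [] := rfl

@[simp] theorem toList_node (l : Tree) (k h : ℕ) (r : Tree) :
    (node l k h r).toList = l.toList ++ k :: r.toList := rfl

@[simp] theorem height_nil : nil.height = 0 := rfl

@[simp] theorem height_node (l : Tree) (k h : ℕ) (r : Tree) : (node l k h r).height = h := rfl

@[simp] theorem isAVL_nil : nil.IsAVL := trivial

@[simp] theorem isAVL_node (l : Tree) (k h : ℕ) (r : Tree) :
    (node l k h r).IsAVL ↔ l.IsAVL ∧ r.IsAVL ∧ h = max l.height r.height + 1 ∧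
      l.height ≤ r.height + 1 ∧ r.height ≤ l.height + 1 := Iff.rfl

@[simp] theorem isBST_nil : nil.IsBST := List.Pairwise.nil

theorem isBST_node (l : Tree) (k h : ℕ) (r : Tree) :
    (node l k h r).IsBST ↔ l.IsBST ∧ r.IsBST ∧ (∀ y ∈ l.toList, y < k) ∧
      ∀ y ∈ r.toList, k < y := by
  simp only [IsBST, toList_node, List.pairwise_append, List.pairwise_cons, List.mem_cons]
  constructor
  · rintro ⟨h1, ⟨h2, h3⟩, h4⟩
    exact ⟨h1, h3, fun y hy => h4 y hy k (Or.inl rfl), h2⟩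
  · rintro ⟨h1, h3, h4, h2⟩
    refine ⟨h1, ⟨h2, h3⟩, fun y hy z hz => ?_⟩
    rcases hz with rfl | hz
    · exact h4 y hy
    · exact (h4 y hy).trans (h2 z hz)

@[simp] theorem mk_val (l : Tree) (k : ℕ) (r : Tree) :
    (mk l k r).val = node l k (max l.height r.height + 1) r := rfl

@[simp] theorem mk_time (l : Tree) (k : ℕ) (r : Tree) : (mk l k r).time = 1 := rfl

@[simp] theorem toList_balL (l : Tree) (k : ℕ) (r : Tree) :
    (balL l k r).val.toList = l.toList ++ k :: r.toList := by
  unfold balL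
  simp only [Timed.bind_val]
  split_ifs
  · split
    · simp
    · split_ifs
      · simp
      · split <;> simp
  · simp

@[simp] theorem toList_balR (l : Tree) (k : ℕ) (r : Tree) :
    (balR l k r).val.toList = l.toList ++ k :: r.toList := by
  unfold balR
  simp only [Timed.bind_val]
  split_ifs
  · split
    · simp
    · split_ifs
      · simp
      · split <;> simp
  · simp

theorem balL_time_le (l : Tree) (k : ℕ) (r : Tree) : (balL l k r).time ≤ 4 := by
  unfold balL
  simp only [Timed.bind_time]
  split_ifs
  · split
    · simp
    · split_ifs
      · simp
      · split <;> simp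
  · simp

theorem balR_time_le (l : Tree) (k : ℕ) (r : Tree) : (balR l k r).time ≤ 4 := by
  unfold balR
  simp only [Timed.bind_time]
  split_ifs
  · split
    · simp
    · split_ifs
      · simp
      · split <;> simp
  · simp

/-- If `l` is two levels too high, the height after the rotation is that of `l` or one more: both
cases occur, the latter only when a removal has lowered `r`. -/
theorem isAVL_balL {l r : Tree} (k : ℕ) (hl : l.IsAVL) (hr : r.IsAVL)
    (h1 : l.height ≤ r.height + 2) (h2 : r.height ≤ l.height + 1) :
    (balL l k r).val.IsAVL ∧ ((balL l k r).val.height = max l.height r.height + 1 ∨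
      l.height = r.height + 2 ∧ (balL l k r).val.height = r.height + 2) := by
  unfold balL
  simp only [Timed.bind_val]
  split_ifs with h
  · split
    · simp at h
    · split_ifs
      · obtain ⟨p, q, _, _, _⟩ := hl
        simp only [height_node] at h h1 h2
        simp only [Timed.bind_val, mk_val, isAVL_node, height_node, p, q, hr, true_and]
        omega
      · split
        · simp_all
        · simp_all; omega
  · exact ⟨⟨hl, hr, rfl, by omega, h2⟩, Or.inl rfl⟩

/-- The mirror image of `isAVL_balL`. -/
theorem isAVL_balR {l r : Tree} (k : ℕ) (hl : l.IsAVL) (hr : r.IsAVL)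
    (h1 : r.height ≤ l.height + 2) (h2 : l.height ≤ r.height + 1) :
    (balR l k r).val.IsAVL ∧ ((balR l k r).val.height = max l.height r.height + 1 ∨
      r.height = l.height + 2 ∧ (balR l k r).val.height = l.height + 2) := by
  unfold balR
  simp only [Timed.bind_val]
  split_ifs with h
  · split
    · simp at h
    · split_ifs
      · obtain ⟨p, q, _, _, _⟩ := hr
        simp only [height_node] at h h1 h2
        simp only [Timed.bind_val, mk_val, isAVL_node, height_node, p, q, hl, true_and]
        omega
      · split
        · simp_all
        · simp_all; omega
  · exact ⟨⟨hl, hr, rfl, h2, by omega⟩, Or.inl rfl⟩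

theorem mem_insert (x : ℕ) (t : Tree) (y : ℕ) :
    y ∈ (t.insert x).val.toList ↔ y = x ∨ y ∈ t.toList := by
  induction t with
  | nil => simp [insert]
  | node l k h r ihl ihr =>
    simp only [insert, Timed.bind_val]
    split_ifs
    · simp [ihl, or_assoc]
    · simp [ihr]; tauto
    · have : x = k := by omega
      subst this
      simp
      tauto

theorem IsBST.insert (x : ℕ) {t : Tree} (ht : t.IsBST) : (t.insert x).val.IsBST := by
  induction t with
  | nil => simp [Tree.insert, IsBST]
  | node l k h r ihl ihr =>
    have ht' := ht
    rw [isBST_node] at ht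
    obtain ⟨hl, hr, h1, h2⟩ := ht
    simp only [Tree.insert, Timed.bind_val]
    split_ifs with c1 c2
    · rw [IsBST, Timed.bind_val, toList_balL, ← toList_node _ _ 0, ← IsBST, isBST_node]
      refine ⟨ihl hl, hr, fun y hy => ?_, h2⟩
      rw [mem_insert] at hy
      rcases hy with rfl | hy
      · exact c1
      · exact h1 y hy
    · rw [IsBST, Timed.bind_val, toList_balR, ← toList_node _ _ 0, ← IsBST, isBST_node]
      refine ⟨hl, ihr hr, h1, fun y hy => ?_⟩
      rw [mem_insert] at hy
      rcases hy with rfl | hy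
      · exact c2
      · exact h2 y hy
    · exact ht'

theorem isAVL_insert (x : ℕ) {t : Tree} (ht : t.IsAVL) :
    (t.insert x).val.IsAVL ∧
      ((t.insert x).val.height = t.height ∨ (t.insert x).val.height = t.height + 1) := by
  induction t with
  | nil => simp [insert]
  | node l k h r ihl ihr =>
    have ht' := ht
    rw [isAVL_node] at ht
    obtain ⟨hl, hr, h1, h2, h3⟩ := ht
    simp only [insert, Timed.bind_val]
    split_ifs
    · obtain ⟨a, b⟩ := ihl hl
      obtain ⟨c, d⟩ := isAVL_balL k a hr (by omega) (by omega)
      refine ⟨c, ?_⟩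
      simp only [height_node, Timed.bind_val]
      omega
    · obtain ⟨a, b⟩ := ihr hr
      obtain ⟨c, d⟩ := isAVL_balR k hl a (by omega) (by omega)
      refine ⟨c, ?_⟩
      simp only [height_node, Timed.bind_val]
      omega
    · exact ⟨ht', Or.inl rfl⟩

theorem insert_time_le (x : ℕ) {t : Tree} (ht : t.IsAVL) :
    (t.insert x).time ≤ 5 * t.height + 2 := by
  induction t with
  | nil => simp [insert]
  | node l k h r ihl ihr =>
    rw [isAVL_node] at ht
    obtain ⟨hl, hr, h1, h2, h3⟩ := ht
    have ihl := ihl hl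
    have ihr := ihr hr
    simp only [insert, Timed.bind_time, Timed.tick_time, height_node]
    split_ifs
    · simp only [Timed.bind_time]
      have := balL_time_le (l.insert x).val k r
      omega
    · simp only [Timed.bind_time]
      have := balR_time_le l k (r.insert x).val
      omega
    · simp

theorem toList_splitMax (l : Tree) (k : ℕ) (r : Tree) :
    (splitMax l k r).val.1.toList ++ [(splitMax l k r).val.2] = l.toList ++ k :: r.toList := by
  induction r generalizing l k with
  | nil => simp [splitMax]
  | node rl rk h rr _ ih =>
    have := ih rl rk
    simp only [splitMax, Timed.bind_val, Timed.pure_val, toList_balL, toList_node,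
      List.append_assoc, List.cons_append]
    rw [this]

theorem isAVL_splitMax {l r : Tree} (k : ℕ) (hl : l.IsAVL) (hr : r.IsAVL)
    (h1 : l.height ≤ r.height + 1) (h2 : r.height ≤ l.height + 1) :
    (splitMax l k r).val.1.IsAVL ∧
      ((splitMax l k r).val.1.height = max l.height r.height + 1 ∨
        (splitMax l k r).val.1.height = max l.height r.height) := by
  induction r generalizing l k with
  | nil => simp [splitMax, hl]
  | node rl rk h rr _ ih =>
    have hr' := hr
    rw [isAVL_node] at hr
    obtain ⟨a, b, c, d, e⟩ := hr
    obtain ⟨f, g⟩ := ih rk a b d e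
    simp only [height_node] at h1 h2 ⊢
    simp only [splitMax, Timed.bind_val, Timed.pure_val]
    obtain ⟨u, v⟩ := isAVL_balL k hl f (by omega) (by omega)
    exact ⟨u, by omega⟩

theorem splitMax_time_le (l : Tree) (k : ℕ) {r : Tree} (hr : r.IsAVL) :
    (splitMax l k r).time ≤ 5 * r.height + 1 := by
  induction r generalizing l k with
  | nil => simp [splitMax]
  | node rl rk h rr _ ih =>
    rw [isAVL_node] at hr
    have := ih rl rk hr.2.1
    have := balL_time_le l k (splitMax rl rk rr).val.1
    simp only [splitMax, Timed.bind_time, Timed.tick_time, Timed.pure_time, height_node]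
    omega

theorem toList_remove (x : ℕ) {t : Tree} (ht : t.IsBST) :
    (t.remove x).val.toList = t.toList.filter (· ≠ x) := by
  induction t with
  | nil => simp [remove]
  | node l k h r ihl ihr =>
    rw [isBST_node] at ht
    obtain ⟨hl, hr, h1, h2⟩ := ht
    have el : k ≤ x → l.toList.filter (· ≠ x) = l.toList := fun hk => by
      rw [List.filter_eq_self]
      intro y hy
      have := h1 y hy
      simp; omega
    have er : x ≤ k → r.toList.filter (· ≠ x) = r.toList := fun hk => by
      rw [List.filter_eq_self]
      intro y hy
      have := h2 y hy
      simp; omega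
    unfold remove
    simp only [Timed.bind_val]
    split_ifs with c1 c2
    · have : k ≠ x := by omega
      rw [Timed.bind_val, toList_balR, ihl hl, toList_node, List.filter_append,
        List.filter_cons_of_pos (by simpa using this), er (by omega)]
    · have : k ≠ x := by omega
      rw [Timed.bind_val, toList_balL, ihr hr, toList_node, List.filter_append,
        List.filter_cons_of_pos (by simpa using this), el (by omega)]
    · have : k = x := by omega
      rw [toList_node, List.filter_append, List.filter_cons_of_neg (by simpa using this),
        el (by omega), er (by omega)]
      split
      · simp
      · rename_i ll lk _ lr
        have := toList_splitMax ll lk lr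
        rw [Timed.bind_val, toList_balR, toList_node, ← this]
        simp

theorem mem_remove (x : ℕ) {t : Tree} (ht : t.IsBST) (y : ℕ) :
    y ∈ (t.remove x).val.toList ↔ y ≠ x ∧ y ∈ t.toList := by
  rw [toList_remove x ht, List.mem_filter]
  simp [and_comm]

theorem IsBST.remove (x : ℕ) {t : Tree} (ht : t.IsBST) : (t.remove x).val.IsBST := by
  rw [IsBST, toList_remove x ht]
  exact List.Pairwise.filter _ ht

theorem isAVL_remove (x : ℕ) {t : Tree} (ht : t.IsAVL) :
    (t.remove x).val.IsAVL ∧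
      ((t.remove x).val.height = t.height ∨ (t.remove x).val.height + 1 = t.height) := by
  induction t with
  | nil => simp [remove]
  | node l k h r ihl ihr =>
    rw [isAVL_node] at ht
    obtain ⟨hl, hr, h1, h2, h3⟩ := ht
    unfold remove
    simp only [Timed.bind_val, height_node]
    split_ifs
    · obtain ⟨a, b⟩ := ihl hl
      obtain ⟨c, d⟩ := isAVL_balR k a hr (by omega) (by omega)
      refine ⟨c, ?_⟩
      rw [Timed.bind_val]
      omega
    · obtain ⟨a, b⟩ := ihr hr
      obtain ⟨c, d⟩ := isAVL_balL k hl a (by omega) (by omega)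
      refine ⟨c, ?_⟩
      rw [Timed.bind_val]
      omega
    · split
      · simp only [height_nil] at h1
        exact ⟨hr, by simp only [Timed.pure_val]; omega⟩
      · rename_i ll lk lh lr
        rw [isAVL_node] at hl
        obtain ⟨a, b, c, d, e⟩ := hl
        obtain ⟨f, g⟩ := isAVL_splitMax lk a b d e
        simp only [height_node] at h1 h2 h3
        obtain ⟨u, v⟩ := isAVL_balR (splitMax ll lk lr).val.2 f hr (by omega) (by omega)
        refine ⟨u, ?_⟩
        rw [Timed.bind_val]
        omega

theorem remove_time_le (x : ℕ) {t : Tree} (ht : t.IsAVL) :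
    (t.remove x).time ≤ 5 * t.height + 1 := by
  induction t with
  | nil => simp [remove]
  | node l k h r ihl ihr =>
    rw [isAVL_node] at ht
    obtain ⟨hl, hr, h1, h2, h3⟩ := ht
    have ihl := ihl hl
    have ihr := ihr hr
    unfold remove
    simp only [Timed.bind_time, Timed.tick_time, height_node]
    split_ifs
    · rw [Timed.bind_time]
      have := balR_time_le (l.remove x).val k r
      omega
    · rw [Timed.bind_time]
      have := balL_time_le l k (r.remove x).val
      omega
    · split
      · simp
      · rename_i ll lk _ lr _
        rw [isAVL_node] at hl
        have := splitMax_time_le ll lk hl.2.1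
        have := balR_time_le (splitMax ll lk lr).val.1 (splitMax ll lk lr).val.2 r
        rw [Timed.bind_time]
        simp only [height_node] at h1
        omega

theorem findMax_time_le (d : ℕ) {t : Tree} (ht : t.IsAVL) :
    (t.findMax d).time ≤ t.height + 1 := by
  induction t generalizing d with
  | nil => simp [findMax]
  | node l k h r _ ihr =>
    rw [isAVL_node] at ht
    have := ihr k ht.2.1
    simp only [findMax, Timed.bind_time, Timed.tick_time, height_node]
    omega

theorem findGT_time_le (x d : ℕ) {t : Tree} (ht : t.IsAVL) :
    (t.findGT x d).time ≤ t.height + 1 := by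
  induction t generalizing d with
  | nil => simp [findGT]
  | node l k h r ihl ihr =>
    rw [isAVL_node] at ht
    have := ihl k ht.1
    have := ihr d ht.2.1
    simp only [findGT, Timed.bind_time, Timed.tick_time, height_node]
    split_ifs <;> omega

theorem findMax_spec (d : ℕ) {t : Tree} (ht : t.IsBST) :
    (t.toList = [] ∧ (t.findMax d).val = d) ∨
      ((t.findMax d).val ∈ t.toList ∧ ∀ y ∈ t.toList, y ≤ (t.findMax d).val) := by
  induction t generalizing d with
  | nil => simp [findMax]
  | node l k h r _ ihr =>
    rw [isBST_node] at ht
    obtain ⟨hl, hr, h1, h2⟩ := ht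
    right
    simp only [findMax, Timed.bind_val, toList_node, List.mem_append, List.mem_cons]
    rcases ihr k hr with ⟨a, b⟩ | ⟨a, b⟩
    · rw [b, a]
      refine ⟨by simp, fun y hy => ?_⟩
      rcases hy with hy | rfl | hy
      · exact (h1 y hy).le
      · exact le_rfl
      · simp at hy
    · refine ⟨Or.inr (Or.inr a), fun y hy => ?_⟩
      have := h2 _ a
      rcases hy with hy | rfl | hy
      · have := h1 y hy; omega
      · omega
      · exact b y hy

theorem findGT_spec (x d : ℕ) {t : Tree} (ht : t.IsBST) :
    ((∀ y ∈ t.toList, y ≤ x) ∧ (t.findGT x d).val = d) ∨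
      ((t.findGT x d).val ∈ t.toList ∧ x < (t.findGT x d).val ∧
        ∀ y ∈ t.toList, x < y → (t.findGT x d).val ≤ y) := by
  induction t generalizing d with
  | nil => simp [findGT]
  | node l k h r ihl ihr =>
    rw [isBST_node] at ht
    obtain ⟨hl, hr, h1, h2⟩ := ht
    simp only [findGT, Timed.bind_val, toList_node, List.mem_append, List.mem_cons]
    split_ifs with hx
    · right
      rcases ihl k hl with ⟨a, b⟩ | ⟨a, b, c⟩
      · rw [b]
        grind
      · grind
    · rcases ihr d hr with ⟨a, b⟩ | ⟨a, b, c⟩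
      · left
        grind
      · right
        grind

/-- An AVL tree of height `h` has at least `2 ^ (h / 2) - 1` keys. -/
theorem two_pow_height_le {t : Tree} (ht : t.IsAVL) :
    2 ^ t.height ≤ (t.toList.length + 1) ^ 2 := by
  induction t with
  | nil => simp
  | node l k h r ihl ihr =>
    rw [isAVL_node] at ht
    obtain ⟨hl, hr, h1, h2, h3⟩ := ht
    have ihl := ihl hl
    have ihr := ihr hr
    -- the case of siblings of different heights, with `a` and `b` the sizes increased by one
    have key : ∀ a b c : ℕ, 2 ^ (c + 1) ≤ a ^ 2 → 2 ^ c ≤ b ^ 2 → 2 ^ (c + 2) ≤ (a + b) ^ 2 := by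
      intro a b c ha hb
      have : b ^ 2 ≤ a ^ 2 ∨ a ^ 2 ≤ b ^ 2 := le_total _ _
      have e1 : 2 ^ (c + 1) = 2 * 2 ^ c := by ring
      have e2 : 2 ^ (c + 2) = 4 * 2 ^ c := by ring
      rcases le_total a b with h | h
      · nlinarith
      · nlinarith
    simp only [height_node, toList_node, List.length_append, List.length_cons]
    rcases lt_trichotomy l.height r.height with hlt | heq | hgt
    · have e : r.height = l.height + 1 := by omega
      have := key _ _ l.height (e ▸ ihr) ihl
      have e' : h = l.height + 2 := by omega
      rw [e']
      calc _ ≤ _ := this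
        _ = _ := by ring
    · have e' : h = l.height + 1 := by omega
      rw [e', pow_succ]
      rw [← heq] at ihr
      nlinarith [Nat.zero_le (l.toList.length * r.toList.length),
        sq_nonneg ((l.toList.length : ℤ) - r.toList.length)]
    · have e : l.height = r.height + 1 := by omega
      have := key _ _ r.height (e ▸ ihl) ihr
      have e' : h = r.height + 2 := by omega
      rw [e']
      calc _ ≤ _ := this
        _ = _ := by ring

end Tree

/-! ### Enumerating the rearrangements of a suffix -/

/-- The word obtained from `u` by exchanging the symbols at the positions `p.1` and `p.2`. Here, as
in the array of the machine, a word of length `n` is a function on `ℕ` whose values from `n` on do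
not matter. -/
def swapWord (u : ℕ → Fin 2) (p : ℕ × ℕ) : ℕ → Fin 2 := fun k => u (Equiv.swap p.1 p.2 k)

/-- The words visited when the exchanges in a list are performed one after the other. -/
def trail (u : ℕ → Fin 2) : List (ℕ × ℕ) → List (ℕ → Fin 2)
  | [] => [u]
  | p :: l => u :: trail (swapWord u p) l

/-- Each exchange in the list is a 2-swap of the word of length `n` to which it is applied. -/
def SwapsValid (n : ℕ) (u : ℕ → Fin 2) : List (ℕ × ℕ) → Prop
  | [] => True
  | p :: l => (p.1 < p.2 ∧ p.2 < n ∧ u p.1 ≠ u p.2) ∧ SwapsValid n (swapWord u p) l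

/-- The number of occurrences of `a` at the positions `s, …, n - 1` of `u`. -/
def suffixCount (n : ℕ) (u : ℕ → Fin 2) (s : ℕ) (a : Fin 2) : ℕ :=
  ((Finset.Ico s n).filter fun k => u k = a).card

/-- The word `v` arises from `u` by rearranging the symbols at the positions `s, …, n - 1`. -/
def IsRearrangement (n : ℕ) (u : ℕ → Fin 2) (s : ℕ) (v : ℕ → Fin 2) : Prop :=
  (∀ k, k < s ∨ n ≤ k → v k = u k) ∧ suffixCount n v s = suffixCount n u s

/-- Performing the list `out` of 2-swaps, starting from `u`, visits every rearrangement of the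
suffix of `u` that starts at `s` exactly once, and no other word; the last word visited is `v`. -/
structure Enumerates (n : ℕ) (u : ℕ → Fin 2) (s : ℕ) (out : List (ℕ × ℕ)) (v : ℕ → Fin 2) :
    Prop where
  valid : SwapsValid n u out
  last : out.foldl swapWord u = v
  nodup : (trail u out).Nodup
  mem_iff : ∀ x, x ∈ trail u out ↔ IsRearrangement n u s x

theorem eq_of_ne_of_ne {a b c : Fin 2} (h1 : a ≠ c) (h2 : b ≠ c) : a = b := by omega

theorem suffixCount_eq_add {n s : ℕ} (h : s < n) (u : ℕ → Fin 2) :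
    suffixCount n u s = suffixCount n u (s + 1) + unit (u s) := by
  funext a
  simp only [suffixCount, unit, Pi.add_apply, ← Finset.insert_Ico_add_one_left_eq_Ico h,
    Finset.filter_insert, Pi.single_apply]
  split_ifs with h1 h2 h2
  · rw [Finset.card_insert_of_notMem (by simp)]
  · exact absurd h1.symm h2
  · exact absurd h2.symm h1
  · rfl

theorem suffixCount_add_suffixCount (n : ℕ) (u : ℕ → Fin 2) (s : ℕ) :
    suffixCount n u s 0 + suffixCount n u s 1 = n - s := by
  have h := Finset.card_filter_add_card_filter_not (s := Finset.Ico s n) (fun k => u k = 0)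
  rw [Nat.card_Ico] at h
  rw [← h, suffixCount, suffixCount]
  congr 2
  ext k
  simp only [Finset.mem_filter]
  have : u k = 1 ↔ ¬ u k = 0 := by omega
  rw [this]

theorem suffixCount_pos_iff {n : ℕ} {u : ℕ → Fin 2} {s : ℕ} {a : Fin 2} :
    0 < suffixCount n u s a ↔ ∃ k, s ≤ k ∧ k < n ∧ u k = a := by
  rw [suffixCount, Finset.card_pos]
  simp [Finset.Nonempty, and_assoc]

theorem suffixCount_swapWord {n : ℕ} (u : ℕ → Fin 2) {s i j : ℕ} (hsi : s ≤ i) (hin : i < n)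
    (hsj : s ≤ j) (hjn : j < n) : suffixCount n (swapWord u (i, j)) s = suffixCount n u s := by
  funext a
  refine Finset.card_equiv (Equiv.swap i j) fun k => ?_
  have : s ≤ Equiv.swap i j k ∧ Equiv.swap i j k < n ↔ s ≤ k ∧ k < n := by
    rw [Equiv.swap_apply_def]
    split_ifs <;> omega
  rw [Finset.mem_filter, Finset.mem_filter, Finset.mem_Ico, Finset.mem_Ico, this]
  rfl

theorem swapWord_of_ne (u : ℕ → Fin 2) {i j k : ℕ} (hi : k ≠ i) (hj : k ≠ j) :
    swapWord u (i, j) k = u k := by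
  rw [swapWord, Equiv.swap_apply_of_ne_of_ne hi hj]

@[simp] theorem swapWord_left (u : ℕ → Fin 2) (i j : ℕ) : swapWord u (i, j) i = u j := by
  simp [swapWord]

@[simp] theorem swapWord_right (u : ℕ → Fin 2) (i j : ℕ) : swapWord u (i, j) j = u i := by
  simp [swapWord]

theorem swapWord_eq_update (u : ℕ → Fin 2) (i j : ℕ) :
    swapWord u (i, j) = Function.update (Function.update u i (u j)) j (u i) := by
  funext k
  by_cases hj : k = j
  · subst hj; simp
  by_cases hi : k = i
  · subst hi; simp [hj]
  rw [swapWord_of_ne u hi hj]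
  simp [hi, hj]

namespace IsRearrangement

variable {n s : ℕ} {u v x : ℕ → Fin 2}

theorem symm (h : IsRearrangement n u s v) : IsRearrangement n v s u :=
  ⟨fun k hk => (h.1 k hk).symm, h.2.symm⟩

theorem trans (h : IsRearrangement n u s v) (h' : IsRearrangement n v s x) :
    IsRearrangement n u s x :=
  ⟨fun k hk => (h'.1 k hk).trans (h.1 k hk), h'.2.trans h.2⟩

theorem swap (u : ℕ → Fin 2) {i j : ℕ} (hsi : s ≤ i) (hij : i < j) (hjn : j < n) :
    IsRearrangement n u s (swapWord u (i, j)) :=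
  ⟨fun _ _ => swapWord_of_ne u (by omega) (by omega),
    suffixCount_swapWord u hsi (by omega) (by omega) hjn⟩

theorem pred (hs : s < n) (h : IsRearrangement n u (s + 1) v) : IsRearrangement n u s v := by
  refine ⟨fun k hk => h.1 k (by omega), ?_⟩
  rw [suffixCount_eq_add hs, suffixCount_eq_add hs, h.2, h.1 s (by omega)]

theorem mono {t : ℕ} (hst : s ≤ t) (ht : t ≤ n) (h : IsRearrangement n u t v) :
    IsRearrangement n u s v := by
  induction t, hst using Nat.le_induction with
  | base => exact h
  | succ t hst ih => exact ih (by omega) (h.pred (by omega))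

theorem succ (hs : s < n) (h : IsRearrangement n u s v) (hv : v s = u s) :
    IsRearrangement n u (s + 1) v := by
  refine ⟨fun k hk => ?_, ?_⟩
  · by_cases e : k = s
    · rw [e, hv]
    · exact h.1 k (by omega)
  · have := h.2
    rw [suffixCount_eq_add hs, suffixCount_eq_add hs, hv] at this
    exact add_right_cancel this

end IsRearrangement

theorem trail_append (u : ℕ → Fin 2) (l : List (ℕ × ℕ)) (p : ℕ × ℕ) (l' : List (ℕ × ℕ)) :
    trail u (l ++ p :: l') = trail u l ++ trail (swapWord (l.foldl swapWord u) p) l' := by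
  induction l generalizing u with
  | nil => rfl
  | cons q l ih => simp [trail, ih]

theorem SwapsValid.append {n : ℕ} {u : ℕ → Fin 2} {l l' : List (ℕ × ℕ)} (h : SwapsValid n u l)
    (h' : SwapsValid n (l.foldl swapWord u) l') : SwapsValid n u (l ++ l') := by
  induction l generalizing u with
  | nil => exact h'
  | cons q l ih => exact ⟨h.1, ih h.2 h'⟩

theorem foldl_mem_trail (u : ℕ → Fin 2) (l : List (ℕ × ℕ)) : l.foldl swapWord u ∈ trail u l := by
  induction l generalizing u with
  | nil => simp [trail]
  | cons q l ih => simp [trail, ih]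

namespace Enumerates

variable {n s : ℕ} {u v : ℕ → Fin 2} {out : List (ℕ × ℕ)}

theorem isRearrangement (h : Enumerates n u s out v) : IsRearrangement n u s v :=
  (h.mem_iff v).1 (h.last ▸ foldl_mem_trail u out)

/-- A constant suffix has no rearrangement but itself. -/
theorem nil_of_const {a : Fin 2} (h : ∀ k, s ≤ k → k < n → u k = a) : Enumerates n u s [] u where
  valid := trivial
  last := rfl
  nodup := by simp [trail]
  mem_iff x := by
    rw [trail, List.mem_singleton]
    constructor
    · rintro rfl
      exact ⟨fun _ _ => rfl, rfl⟩
    · rintro ⟨h1, h2⟩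
      funext k
      by_cases hk : k < s ∨ n ≤ k
      · exact h1 k hk
      · rw [not_or, not_lt, not_le] at hk
        rw [h k hk.1 hk.2]
        by_contra hne
        obtain ⟨k', hk'⟩ := suffixCount_pos_iff.1
          ((congrFun h2 (x k)) ▸ suffixCount_pos_iff.2 ⟨k, hk.1, hk.2, rfl⟩)
        exact hne (hk'.2.2 ▸ h k' hk'.1 hk'.2.1)

/-- The rearrangements of the suffix that starts at `i` are those that keep the symbol at `i` and
those that change it, and a 2-swap at `i` leads from the former to the latter. -/
theorem append {i j : ℕ} {v' : ℕ → Fin 2} {out' : List (ℕ × ℕ)}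
    (h : Enumerates n u (i + 1) out v) (hij : i < j) (hjn : j < n) (hne : v i ≠ v j)
    (h' : Enumerates n (swapWord v (i, j)) (i + 1) out' v') :
    Enumerates n u i (out ++ (i, j) :: out') v' := by
  have hvi : v i = u i := h.isRearrangement.1 i (by omega)
  have hin : i < n := hij.trans hjn
  have hw : IsRearrangement n u i (swapWord v (i, j)) :=
    (h.isRearrangement.pred hin).trans (.swap v le_rfl hij hjn)
  have hwi : swapWord v (i, j) i ≠ u i := by
    rw [swapWord_left, ← hvi]
    exact hne.symm
  refine ⟨h.valid.append ?_, ?_, ?_, fun x => ?_⟩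
  · rw [h.last]
    exact ⟨⟨hij, hjn, hne⟩, h'.valid⟩
  · rw [List.foldl_append, h.last, List.foldl_cons, h'.last]
  · rw [trail_append, h.last]
    refine List.Nodup.append h.nodup h'.nodup fun x hx hx' => hwi ?_
    rw [h.mem_iff] at hx
    rw [h'.mem_iff] at hx'
    rw [← hx'.1 i (by omega), hx.1 i (by omega)]
  · rw [trail_append, h.last, List.mem_append, h.mem_iff, h'.mem_iff]
    constructor
    · rintro (hx | hx)
      · exact hx.pred hin
      · exact hw.trans (hx.pred hin)
    · intro hx
      by_cases hxi : x i = u i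
      · exact Or.inl (hx.succ hin hxi)
      · exact Or.inr ((hw.symm.trans hx).succ hin (eq_of_ne_of_ne hxi hwi))

end Enumerates

/-! ### The time of a tree operation -/

/-- A bound on the height of an AVL tree with at most `n` keys. -/
def heightBound (n : ℕ) : ℕ := Nat.log 2 ((n + 1) ^ 2)

/-- A bound on the number of steps of an operation on an AVL tree with at most `n` keys. -/
def opTime (n : ℕ) : ℕ := 5 * heightBound n + 2

/-- An AVL search tree whose keys are positions of a word of length `n`. -/
structure Tree.IsPosTree (n : ℕ) (t : Tree) : Prop where
  avl : t.IsAVL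
  bst : t.IsBST
  lt : ∀ k ∈ t.toList, k < n

namespace Tree.IsPosTree

variable {n x : ℕ} {t : Tree}

theorem height_le (h : t.IsPosTree n) : t.height ≤ heightBound n := by
  have hlen : t.toList.length ≤ n := by
    rw [← List.toFinset_card_of_nodup (h.bst.imp ne_of_lt), ← Finset.card_range n]
    refine Finset.card_le_card fun k hk => ?_
    rw [List.mem_toFinset] at hk
    exact Finset.mem_range.2 (h.lt k hk)
  refine Nat.le_log_of_pow_le one_lt_two ((two_pow_height_le h.avl).trans ?_)
  gcongr

theorem insert (h : t.IsPosTree n) (hx : x < n) : (t.insert x).val.IsPosTree n where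
  avl := (isAVL_insert x h.avl).1
  bst := h.bst.insert x
  lt k hk := by
    rcases (mem_insert x t k).1 hk with rfl | hk
    · exact hx
    · exact h.lt k hk

theorem remove (h : t.IsPosTree n) (x : ℕ) : (t.remove x).val.IsPosTree n where
  avl := (isAVL_remove x h.avl).1
  bst := h.bst.remove x
  lt k hk := h.lt k ((mem_remove x h.bst k).1 hk).2

theorem insert_time_le (h : t.IsPosTree n) (x : ℕ) : (t.insert x).time ≤ opTime n := by
  have := Tree.insert_time_le x h.avl
  have := h.height_le
  unfold opTime
  omega

theorem remove_time_le (h : t.IsPosTree n) (x : ℕ) : (t.remove x).time ≤ opTime n := by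
  have := Tree.remove_time_le x h.avl
  have := h.height_le
  unfold opTime
  omega

theorem findMax_time_le (h : t.IsPosTree n) (d : ℕ) : (t.findMax d).time ≤ opTime n := by
  have := Tree.findMax_time_le d h.avl
  have := h.height_le
  unfold opTime
  omega

theorem findGT_time_le (h : t.IsPosTree n) (x d : ℕ) : (t.findGT x d).time ≤ opTime n := by
  have := Tree.findGT_time_le x d h.avl
  have := h.height_le
  unfold opTime
  omega

end Tree.IsPosTree

/-! ### The invariants of the machine -/

/-- The trees are AVL search trees that store the positions of the two symbols in the array. -/
structure Machine.Valid (n : ℕ) (M : Machine) : Prop where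
  avl : ∀ a, (M.tree a).IsAVL
  bst : ∀ a, (M.tree a).IsBST
  mem_iff : ∀ a k, k ∈ (M.tree a).toList ↔ k < n ∧ M.word k = a

theorem Machine.Valid.isPosTree {n : ℕ} {M : Machine} (h : M.Valid n) (a : Fin 2) :
    (M.tree a).IsPosTree n :=
  ⟨h.avl a, h.bst a, fun k hk => ((h.mem_iff a k).1 hk).1⟩

/-- The bound on the delay between two outputs, in steps. Between two outputs there are at most the
four operations of `applySwap`, two searches for a maximum, the search of `swapNext`, and a bounded
number of other steps. -/
def maxDelay (n : ℕ) : ℕ := 10 * opTime n + 20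

/-- The delays between the outputs so far are at most `maxDelay n`, and the next output will not be
late if it comes within `c` steps. -/
def Machine.Paced (n t₀ c : ℕ) (M : Machine) : Prop :=
  List.IsChain (fun s t => t ≤ s + maxDelay n) ((t₀ :: M.outputTimes) ++ [M.clock + c])

namespace Machine.Paced

variable {n t₀ c c' : ℕ} {M M' : Machine}

theorem of_log_eq (h : M.Paced n t₀ c) (hlog : M'.log = M.log)
    (hclock : M'.clock + c' ≤ M.clock + c) : M'.Paced n t₀ c' := by
  unfold Paced outputTimes at *
  rw [List.isChain_append] at h ⊢
  rw [hlog]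
  refine ⟨h.1, List.isChain_singleton _, fun x hx y hy => ?_⟩
  have := h.2.2 x hx (M.clock + c) (by simp)
  simp only [List.head?_cons, Option.mem_some_iff] at hy
  omega

theorem of_log_append {p : ℕ × ℕ} {t : ℕ} (h : M.Paced n t₀ c)
    (hlog : M'.log = M.log ++ [(p, t)]) (ht : t ≤ M.clock + c)
    (hclock : M'.clock + c' ≤ t + maxDelay n) : M'.Paced n t₀ c' := by
  unfold Paced outputTimes at *
  rw [List.isChain_append] at h ⊢
  rw [hlog, List.map_append, List.map_singleton, ← List.cons_append]
  refine ⟨?_, List.isChain_singleton _, fun x hx y hy => ?_⟩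
  · rw [List.isChain_append]
    refine ⟨h.1, List.isChain_singleton _, fun x hx y hy => ?_⟩
    have := h.2.2 x hx (M.clock + c) (by simp)
    simp only [List.head?_cons, Option.mem_some_iff] at hy
    omega
  · rw [List.getLast?_concat] at hx
    simp only [List.head?_cons, Option.mem_some_iff] at hx hy
    omega

end Machine.Paced

/-- The effect of `applySwap`. As the two symbols differ, the operations on one tree do not
interfere with those on the other. -/
theorem applySwap_run (M : Machine) {i j : ℕ} (hne : M.word i ≠ M.word j) :
    (applySwap i j).run M = ((),
      { word := swapWord M.word (i, j)
        tree := Function.update (Function.update M.tree (M.word i)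
            (((M.tree (M.word i)).remove i).val.insert j).val)
          (M.word j) (((M.tree (M.word j)).remove j).val.insert i).val
        clock := M.clock + 1 + 1 + ((M.tree (M.word i)).remove i).time +
          (((M.tree (M.word i)).remove i).val.insert j).time +
          ((M.tree (M.word j)).remove j).time +
          (((M.tree (M.word j)).remove j).val.insert i).time + 1 + 1
        log := M.log }) := by
  simp only [applySwap, removeFrom, insertInto, readCell, writeCell, runTimed, charge,
    StateT.run_bind, StateT.run_modify, StateT.run_get, StateT.run_pure, pure_bind]
  simp [swapWord_eq_update, Function.update_of_ne hne.symm, Function.update_idem]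
  rfl

/-- Outputting and performing a 2-swap keeps the trees correct and leaves enough time to reach the
next output. -/
theorem output_applySwap_run {n t₀ : ℕ} {M : Machine} (hM : M.Valid n) (hP : M.Paced n t₀ 1)
    {i j : ℕ} (hij : i < j) (hjn : j < n) (hne : M.word i ≠ M.word j) :
    ∃ M' : Machine, (do output i j; applySwap i j : Exec Unit).run M = ((), M') ∧ M'.Valid n ∧
      M'.Paced n t₀ (4 * opTime n + 10) ∧ M'.outputs = M.outputs ++ [(i, j)] ∧
      M'.word = swapWord M.word (i, j) := by
  set M₁ : Machine :=
    { M with clock := M.clock + 1, log := M.log ++ [((i, j), M.clock + 1)] } with hM₁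
  have hrun : (do output i j; applySwap i j : Exec Unit).run M = (applySwap i j).run M₁ := rfl
  rw [hrun, applySwap_run M₁ hne]
  have ha := hM.isPosTree (M.word i)
  have hb := hM.isPosTree (M.word j)
  have ha' := ha.remove i
  have hb' := hb.remove j
  have ha'' := ha'.insert hjn
  have hb'' := hb'.insert (hij.trans hjn)
  refine ⟨_, rfl, ⟨fun a => ?_, fun a => ?_, fun a k => ?_⟩, ?_, ?_, rfl⟩
  · dsimp only [M₁]
    by_cases h : a = M.word j
    · subst h
      simpa using hb''.avl
    · rw [Function.update_of_ne h, eq_of_ne_of_ne h hne]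
      simpa using ha''.avl
  · dsimp only [M₁]
    by_cases h : a = M.word j
    · subst h
      simpa using hb''.bst
    · rw [Function.update_of_ne h, eq_of_ne_of_ne h hne]
      simpa using ha''.bst
  · dsimp only [M₁]
    have hk : k = i ∨ k = j ∨ k ≠ i ∧ k ≠ j := by tauto
    by_cases h : a = M.word j
    · subst h
      rw [Function.update_self, Tree.mem_insert, Tree.mem_remove _ hb.bst, hM.mem_iff]
      rcases hk with rfl | rfl | ⟨h1, h2⟩
      · simp; omega
      · simp [hne]; omega
      · simp [h1, h2, swapWord_of_ne]
    · rw [Function.update_of_ne h, eq_of_ne_of_ne h hne]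
      rw [Function.update_self, Tree.mem_insert, Tree.mem_remove _ ha.bst, hM.mem_iff]
      rcases hk with rfl | rfl | ⟨h1, h2⟩
      · simp [hne.symm]; omega
      · simp; omega
      · simp [h1, h2, swapWord_of_ne]
  · refine hP.of_log_append (M' := ⟨_, _, _, _⟩) (p := (i, j)) (t := M.clock + 1) rfl le_rfl ?_
    have := ha.remove_time_le i
    have := hb.remove_time_le j
    have := ha'.insert_time_le j
    have := hb'.insert_time_le i
    simp only [M₁, maxDelay]
    omega
  · simp [M₁, Machine.outputs]

/-- The search of `swapNext` succeeds if both symbols occur from position `i` on. -/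
theorem swapNext_run {n t₀ : ℕ} {M : Machine} (hM : M.Valid n)
    (hP : M.Paced n t₀ (opTime n + 2)) {i : ℕ} (hi : ∀ a, 0 < suffixCount n M.word i a) :
    ∃ (j : ℕ) (M' : Machine), (swapNext i).run M = (M'.word i, M') ∧ i < j ∧ j < n ∧
      M.word i ≠ M.word j ∧ M'.Valid n ∧ M'.Paced n t₀ (4 * opTime n + 10) ∧
      M'.outputs = M.outputs ++ [(i, j)] ∧ M'.word = swapWord M.word (i, j) := by
  have hother : other (M.word i) ≠ M.word i := by
    generalize M.word i = a
    revert a; decide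
  set j := ((M.tree (other (M.word i))).findGT i i).val with hj
  have hT := hM.isPosTree (other (M.word i))
  obtain ⟨hij, hmem⟩ : i < j ∧ j ∈ (M.tree (other (M.word i))).toList := by
    obtain ⟨k, hk1, hk2, hk3⟩ := suffixCount_pos_iff.1 (hi (other (M.word i)))
    have hki : k ≠ i := by
      rintro rfl
      exact hother hk3.symm
    have hk := (hM.mem_iff _ k).2 ⟨hk2, hk3⟩
    rcases Tree.findGT_spec i i hT.bst with ⟨h, _⟩ | ⟨h1, h2, _⟩
    · have := h k hk
      omega
    · exact ⟨h2, h1⟩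
  obtain ⟨hjn, hwj⟩ := (hM.mem_iff _ j).1 hmem
  have hne : M.word i ≠ M.word j := by
    rw [hwj]
    exact hother.symm
  set M₁ : Machine := { M with
    clock := M.clock + 1 + ((M.tree (other (M.word i))).findGT i i).time } with hM₁
  have hP₁ : M₁.Paced n t₀ 1 := by
    refine hP.of_log_eq rfl ?_
    have := hT.findGT_time_le i i
    simp only [M₁]
    omega
  obtain ⟨M', h1, h2, h3, h4, h5⟩ :=
    output_applySwap_run (M := M₁) ⟨hM.avl, hM.bst, hM.mem_iff⟩ hP₁ hij hjn hne
  refine ⟨j, M', ?_, hij, hjn, hne, h2, h3, h4, h5⟩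
  have hrun : (swapNext i).run M =
      (other (M.word i), ((do output i j; applySwap i j : Exec Unit).run M₁).2) := rfl
  rw [hrun, h1, h5, swapWord_left, ← hwj]

theorem findMax_of_suffixCount_pos {n s : ℕ} {M : Machine} (hM : M.Valid n) {a : Fin 2}
    (h : 0 < suffixCount n M.word s a) :
    s ≤ ((M.tree a).findMax 0).val ∧ ((M.tree a).findMax 0).val < n ∧
      M.word ((M.tree a).findMax 0).val = a ∧
      ∀ k, k < n → M.word k = a → k ≤ ((M.tree a).findMax 0).val := by
  obtain ⟨k, hk1, hk2, hk3⟩ := suffixCount_pos_iff.1 h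
  have hk := (hM.mem_iff _ k).2 ⟨hk2, hk3⟩
  rcases Tree.findMax_spec 0 (hM.bst a) with ⟨h, _⟩ | ⟨h1, h2⟩
  · rw [h] at hk
    simp at hk
  · have := (hM.mem_iff _ _).1 h1
    exact ⟨hk1.trans (h2 k hk), this.1, this.2, fun k hk hk' => h2 k ((hM.mem_iff _ k).2 ⟨hk, hk'⟩)⟩

/-! ### The run of the algorithm -/

/-- The state reached after one iteration of `step`. -/
def next (n : ℕ) (s : Control × Machine) : Control × Machine := (step n s.1).run s.2

/-- The state reached by returning to `ls`. -/
def afterReturn (ls : Pointer) (M : Machine) : Control × Machine := (returnTo ls).run M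

/-- Some number of iterations of `step` leads from one state to the other. -/
def Reaches (n : ℕ) (s s' : Control × Machine) : Prop := ∃ k, (next n)^[k] s = s'

theorem Reaches.trans {n : ℕ} {s s' s'' : Control × Machine} (h : Reaches n s s')
    (h' : Reaches n s' s'') : Reaches n s s'' := by
  obtain ⟨k, rfl⟩ := h
  obtain ⟨k', rfl⟩ := h'
  exact ⟨k' + k, Function.iterate_add_apply _ _ _ _⟩

theorem Reaches.of_next {n : ℕ} {s s' : Control × Machine} (h : next n s = s') :
    Reaches n s s' := ⟨1, h⟩

/-- The state of the machine when, since the time when the outputs were `pre` and the word was `u`,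
the rearrangements of the suffix of `u` that starts at `s` have been enumerated; `c` steps are left
for the next output. -/
structure Machine.Progress (n t₀ : ℕ) (pre : List (ℕ × ℕ)) (u : ℕ → Fin 2) (s c : ℕ)
    (M : Machine) : Prop where
  valid : M.Valid n
  paced : M.Paced n t₀ c
  enumerates : ∃ out, M.outputs = pre ++ out ∧ Enumerates n u s out M.word

variable {n t₀ : ℕ}

theorem next_call_of_zero {P : Fin 2 → ℕ} (hP : P 0 = 0 ∨ P 1 = 0) (ls : Pointer) (M : Machine) :
    next n (.call P ls, M) = afterReturn ls { M with clock := M.clock + 1 } := by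
  simp only [next, step, if_pos hP]
  rfl

theorem next_call_of_one {P : Fin 2 → ℕ} (hP : P 0 = 1 ∧ P 1 = 1) (ls : Pointer) (M : Machine) :
    next n (.call P ls, M) = afterReturn ls
      ((do output (n - 2) (n - 1); applySwap (n - 2) (n - 1) : Exec Unit).run
        { M with clock := M.clock + 1 }).2 := by
  have h0 : ¬ (P 0 = 0 ∨ P 1 = 0) := by omega
  simp only [next, step, if_neg h0, if_pos hP]
  rfl

theorem next_call_of_ne {P : Fin 2 → ℕ} (h0 : ¬ (P 0 = 0 ∨ P 1 = 0)) (h1 : ¬ (P 0 = 1 ∧ P 1 = 1))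
    (ls : Pointer) (M : Machine) {i : ℕ}
    (hi : i = min ((M.tree 0).findMax 0).val ((M.tree 1).findMax 0).val) :
    next n (.call P ls, M) =
      (.loop P i (unit (M.word i) + (n - 1 - i) • unit (other (M.word i))) ls,
        { M with clock := M.clock + 1 + ((M.tree 0).findMax 0).time +
          ((M.tree 1).findMax 0).time + 1 }) := by
  subst hi
  simp only [next, step, if_neg h0, if_neg h1]
  rfl

theorem next_loop_of_lt {P : Fin 2 → ℕ} {i : ℕ} (h : n - (P 0 + P 1) < i) (Q : Fin 2 → ℕ)
    (ls : Pointer) (M : Machine) {c : Fin 2} {M' : Machine}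
    (hM' : (swapNext i).run { M with clock := M.clock + 1 } = (c, M')) :
    next n (.loop P i Q ls, M) = (.call (Q - unit c) (⟨P, i, Q⟩ :: ls), M') := by
  have : next n (.loop P i Q ls, M) =
      (fun x : Fin 2 × Machine => (Control.call (Q - unit x.1) (⟨P, i, Q⟩ :: ls), x.2))
        ((swapNext i).run { M with clock := M.clock + 1 }) := by
    simp only [next, step, if_pos h]
    rfl
  rw [this, hM']

theorem next_loop_of_eq {P : Fin 2 → ℕ} {i : ℕ} (h : n - (P 0 + P 1) = i) (Q : Fin 2 → ℕ)
    (ls : Pointer) (M : Machine) {c : Fin 2} {M' : Machine}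
    (hM' : (swapNext i).run { M with clock := M.clock + 1 } = (c, M')) :
    next n (.loop P i Q ls, M) = (.call (P - unit c) ls, M') := by
  have : next n (.loop P i Q ls, M) =
      (fun x : Fin 2 × Machine => (Control.call (P - unit x.1) ls, x.2))
        ((swapNext i).run { M with clock := M.clock + 1 }) := by
    subst h
    simp only [next, step, if_neg (lt_irrefl _)]
    rfl
  rw [this, hM']

theorem afterReturn_cons (f : Frame) (ls : Pointer) (M : Machine) :
    afterReturn (f :: ls) M =
      (.loop f.P (f.i - 1) (f.Q + unit (M.word (f.i - 1))) ls,
        { M with clock := M.clock + 1 + 1 }) := rfl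

/-- A call on the suffix that starts at `s`, with enough time left for the next output, enumerates
the rearrangements of this suffix, and then returns to the given state. -/
def CallCorrect (n t₀ s : ℕ) : Prop :=
  ∀ (ls : Pointer) (M : Machine), M.Valid n → M.Paced n t₀ (4 * opTime n + 10) →
    ∃ M' : Machine,
      Reaches n (.call (suffixCount n M.word s) ls, M) (afterReturn ls M') ∧
      M'.Progress n t₀ M.outputs M.word s (opTime n + 5)

/-- The exchange at `i` in the loop, followed by the call on the suffix that starts at `i + 1`,
turns an enumeration of the rearrangements of this suffix into one of the rearrangements of the
suffix that starts at `i`. -/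
theorem swapNext_call {i : ℕ} (hcall : CallCorrect n t₀ (i + 1)) {pre : List (ℕ × ℕ)}
    {u : ℕ → Fin 2} {M : Machine} (hM : M.Progress n t₀ pre u (i + 1) (opTime n + 3))
    (hpos : ∀ a, 0 < suffixCount n M.word i a) :
    ∃ (c : Fin 2) (M₁ : Machine),
      (swapNext i).run { M with clock := M.clock + 1 } = (c, M₁) ∧
      ∀ ls, ∃ M₂ : Machine,
        Reaches n (.call (suffixCount n M.word i - unit c) ls, M₁) (afterReturn ls M₂) ∧
        IsRearrangement n M.word i M₂.word ∧
        M₂.Progress n t₀ pre u i (opTime n + 5) := by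
  obtain ⟨out, hout, hen⟩ := hM.enumerates
  obtain ⟨j, M₁, hrun, hij, hjn, hne, hval, hpaced, houts, hword⟩ :=
    swapNext_run (M := { M with clock := M.clock + 1 })
      ⟨hM.valid.avl, hM.valid.bst, hM.valid.mem_iff⟩
      (hM.paced.of_log_eq rfl (by dsimp only; omega)) hpos
  have hin : i < n := hij.trans hjn
  refine ⟨_, M₁, hrun, fun ls => ?_⟩
  obtain ⟨M₂, hreach, hprog⟩ := hcall ls M₁ hval hpaced
  have hcount : suffixCount n M₁.word i = suffixCount n M.word i := by
    rw [hword]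
    exact suffixCount_swapWord M.word le_rfl hin hij.le hjn
  obtain ⟨out', hout', hen'⟩ := hprog.enumerates
  refine ⟨M₂, ?_, ?_, hprog.valid, hprog.paced, out ++ (i, j) :: out', ?_, ?_⟩
  · rw [← hcount, suffixCount_eq_add hin, add_tsub_cancel_right]
    exact hreach
  · have := hen'.isRearrangement.pred hin
    rw [hword] at this
    exact (IsRearrangement.swap M.word le_rfl hij hjn).trans this
  · have : M.outputs = pre ++ out := hout
    rw [hout', houts]
    simp [Machine.outputs] at this ⊢
    rw [this]
    simp
  · rw [hword] at hen'
    exact hen.append hij hjn hne hen'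

/-- The loop, entered at `i` when the rearrangements of the suffix that starts at `i + 1` have been
enumerated, enumerates those of the suffix that starts at `s`. -/
theorem loop_correct {s : ℕ} (hcall : ∀ s', s < s' → CallCorrect n t₀ s') (ls : Pointer)
    {pre : List (ℕ × ℕ)} {u : ℕ → Fin 2} {i : ℕ} (hsi : s ≤ i) {M : Machine}
    (hM : M.Progress n t₀ pre u (i + 1) (opTime n + 3))
    (hpos : ∀ a, 0 < suffixCount n M.word i a) :
    ∃ M' : Machine,
      Reaches n (.loop (suffixCount n M.word s) i (suffixCount n M.word i) ls, M)
        (afterReturn ls M') ∧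
      M'.Progress n t₀ pre u s (opTime n + 5) := by
  have hin : i < n := by
    obtain ⟨k, h1, h2, -⟩ := suffixCount_pos_iff.1 (hpos 0)
    omega
  have hs : n - (suffixCount n M.word s 0 + suffixCount n M.word s 1) = s := by
    rw [suffixCount_add_suffixCount]
    omega
  obtain ⟨c, M₁, hrun, h⟩ := swapNext_call (hcall (i + 1) (by omega)) hM hpos
  induction i, hsi using Nat.le_induction generalizing M c M₁ with
  | base =>
    obtain ⟨M₂, h1, -, h3⟩ := h ls
    exact ⟨M₂, (Reaches.of_next (next_loop_of_eq hs _ _ _ hrun)).trans h1, h3⟩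
  | succ i hsi ih =>
    obtain ⟨M₂, h1, h2, h3⟩ :=
      h (⟨suffixCount n M.word s, i + 1, suffixCount n M.word (i + 1)⟩ :: ls)
    have h1' := (Reaches.of_next (next_loop_of_lt (by omega) _ _ _ hrun)).trans h1
    -- after the return, the loop resumes at `i` with the counts of the suffix that starts at `i`
    rw [afterReturn_cons, Nat.add_sub_cancel, ← h2.2, ← suffixCount_eq_add (by omega)] at h1'
    have hsM : suffixCount n M₂.word s = suffixCount n M.word s :=
      (h2.mono (by omega) hin.le).2
    have hM₃ : Machine.Progress n t₀ pre u (i + 1) (opTime n + 3)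
        { M₂ with clock := M₂.clock + 1 + 1 } :=
      ⟨⟨h3.valid.avl, h3.valid.bst, h3.valid.mem_iff⟩,
        h3.paced.of_log_eq rfl (by dsimp only; omega), h3.enumerates⟩
    have hpos₃ : ∀ a, 0 < suffixCount n M₂.word i a := fun a => by
      have := hpos a
      rw [suffixCount_eq_add (by omega), h2.2]
      simp only [Pi.add_apply]
      omega
    obtain ⟨c', M₄, hrun', h'⟩ := swapNext_call (hcall (i + 1) (by omega)) hM₃ hpos₃
    obtain ⟨M', h4, h5⟩ := ih hM₃ hpos₃ (by omega) (by rwa [← hsM] at hs) c' M₄ hrun' h'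
    dsimp only at h4
    rw [hsM] at h4
    exact ⟨M', h2.2 ▸ h1'.trans h4, h5⟩

theorem suffixCount_of_const {u : ℕ → Fin 2} {s : ℕ} {a : Fin 2}
    (h : ∀ k, s ≤ k → k < n → u k = a) : suffixCount n u s = (n - s) • unit a := by
  funext b
  simp only [suffixCount, unit, Pi.smul_apply, Pi.single_apply, smul_eq_mul]
  split_ifs with hb
  · rw [Finset.filter_true_of_mem, Nat.card_Ico, mul_one]
    intro k hk
    rw [Finset.mem_Ico] at hk
    rw [h k hk.1 hk.2, hb]
  · rw [Finset.filter_false_of_mem, Finset.card_empty, mul_zero]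
    intro k hk hk'
    rw [Finset.mem_Ico] at hk
    exact hb (by rw [← hk', h k hk.1 hk.2])

theorem callCorrect_of_zero {s : ℕ} {M : Machine} (hM : M.Valid n)
    (hP : M.Paced n t₀ (4 * opTime n + 10)) (ls : Pointer)
    (h : suffixCount n M.word s 0 = 0 ∨ suffixCount n M.word s 1 = 0) :
    ∃ M' : Machine,
      Reaches n (.call (suffixCount n M.word s) ls, M) (afterReturn ls M') ∧
      M'.Progress n t₀ M.outputs M.word s (opTime n + 5) := by
  refine ⟨_, Reaches.of_next (next_call_of_zero h ls M), ⟨hM.avl, hM.bst, hM.mem_iff⟩,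
    hP.of_log_eq rfl (by dsimp only; omega), [], by simp [Machine.outputs], ?_⟩
  obtain ⟨a, ha⟩ : ∃ a, suffixCount n M.word s a = 0 := h.elim (⟨0, ·⟩) (⟨1, ·⟩)
  have hne : ∀ k, s ≤ k → k < n → M.word k ≠ a := fun k h1 h2 h3 =>
    (suffixCount_pos_iff.2 ⟨k, h1, h2, h3⟩).ne' ha
  have hother : other a ≠ a := by
    clear ha hne
    revert a; decide
  exact Enumerates.nil_of_const (a := other a) fun k h1 h2 =>
    eq_of_ne_of_ne (hne k h1 h2) hother

theorem callCorrect_of_one {s : ℕ} {M : Machine} (hM : M.Valid n)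
    (hP : M.Paced n t₀ (4 * opTime n + 10)) (ls : Pointer)
    (h : suffixCount n M.word s 0 = 1 ∧ suffixCount n M.word s 1 = 1) :
    ∃ M' : Machine,
      Reaches n (.call (suffixCount n M.word s) ls, M) (afterReturn ls M') ∧
      M'.Progress n t₀ M.outputs M.word s (opTime n + 5) := by
  have hsum := suffixCount_add_suffixCount n M.word s
  rw [h.1, h.2] at hsum
  obtain rfl : n = s + 2 := by omega
  have hne : M.word s ≠ M.word (s + 1) := by
    intro he
    have h1 : suffixCount (s + 2) M.word s (M.word s) = 1 := by
      generalize M.word s = a at *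
      have ha : a = 0 ∨ a = 1 := by omega
      rcases ha with rfl | rfl
      · exact h.1
      · exact h.2
    rw [suffixCount_eq_add (by omega), suffixCount_eq_add (by omega), he] at h1
    simp [unit] at h1
  set M₁ : Machine := { M with clock := M.clock + 1 } with hM₁
  obtain ⟨M', h1, h2, h3, h4, h5⟩ := output_applySwap_run (M := M₁) (t₀ := t₀)
    ⟨hM.avl, hM.bst, hM.mem_iff⟩ (hP.of_log_eq rfl (by dsimp only [M₁]; omega))
    (lt_add_one s) (by omega : s + 1 < s + 2) hne
  have hnext := next_call_of_one (n := s + 2) h ls M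
  simp only [Nat.add_sub_cancel, show s + 2 - 1 = s + 1 by omega] at hnext
  rw [← hM₁, h1] at hnext
  refine ⟨M', Reaches.of_next hnext, h2, h3.of_log_eq rfl (by omega), [] ++ (s, s + 1) :: [],
    h4, ?_⟩
  rw [h5]
  exact (Enumerates.nil_of_const (a := M.word (s + 1)) fun k h1 h2 => by
      rw [show k = s + 1 by omega]).append (lt_add_one s) (by omega) hne
    (Enumerates.nil_of_const (a := M.word s) fun k h1 h2 => by
      rw [show k = s + 1 by omega, swapWord_right])

theorem callCorrect_of_ne {s : ℕ} (hcall : ∀ s', s < s' → CallCorrect n t₀ s') {M : Machine}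
    (hM : M.Valid n) (hP : M.Paced n t₀ (4 * opTime n + 10)) (ls : Pointer)
    (h0 : ¬ (suffixCount n M.word s 0 = 0 ∨ suffixCount n M.word s 1 = 0))
    (h1 : ¬ (suffixCount n M.word s 0 = 1 ∧ suffixCount n M.word s 1 = 1)) :
    ∃ M' : Machine,
      Reaches n (.call (suffixCount n M.word s) ls, M) (afterReturn ls M') ∧
      M'.Progress n t₀ M.outputs M.word s (opTime n + 5) := by
  have hnext := next_call_of_ne (n := n) h0 h1 ls M rfl
  have hR : ∀ a, ((M.tree a).findMax 0).time ≤ opTime n :=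
    fun a => (hM.isPosTree a).findMax_time_le 0
  obtain ⟨a1, a2, a3, a4⟩ := findMax_of_suffixCount_pos (s := s) hM (a := 0) (by omega)
  obtain ⟨b1, b2, b3, b4⟩ := findMax_of_suffixCount_pos (s := s) hM (a := 1) (by omega)
  set R₁ := ((M.tree 0).findMax 0).val
  set R₂ := ((M.tree 1).findMax 0).val
  have hR₁₂ : R₁ ≠ R₂ := by
    intro e
    rw [e, b3] at a3
    exact absurd a3 (by decide)
  set i := min R₁ R₂ with hi
  have hsi : s ≤ i := le_min a1 b1
  have hin : i < n := by omega
  -- `i` is the last position of its symbol, and the other symbol occurs after it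
  have hconst : ∀ k, i + 1 ≤ k → k < n → M.word k = other (M.word i) := by
    intro k hk1 hk2
    have a4' := a4 k hk2
    have b4' := b4 k hk2
    rcases lt_or_gt_of_ne hR₁₂ with hlt | hlt
    · rw [hi, min_eq_left hlt.le, a3]
      have : M.word k ≠ 0 := fun e => by have := a4' e; omega
      exact eq_of_ne_of_ne this (by decide)
    · rw [hi, min_eq_right hlt.le, b3]
      have : M.word k ≠ 1 := fun e => by have := b4' e; omega
      exact eq_of_ne_of_ne this (by decide)
  have hQ : unit (M.word i) + (n - 1 - i) • unit (other (M.word i)) =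
      suffixCount n M.word i := by
    rw [suffixCount_eq_add hin, suffixCount_of_const hconst, add_comm, Nat.sub_sub, add_comm 1]
  rw [hQ] at hnext
  have hpos : ∀ a, 0 < suffixCount n M.word i a := by
    intro a
    have ha : a = 0 ∨ a = 1 := by omega
    rcases ha with rfl | rfl
    · exact suffixCount_pos_iff.2 ⟨R₁, min_le_left _ _, a2, a3⟩
    · exact suffixCount_pos_iff.2 ⟨R₂, min_le_right _ _, b2, b3⟩
  obtain ⟨M', h2, h3⟩ := loop_correct hcall ls hsi (pre := M.outputs) (u := M.word)
    (M := { M with clock := M.clock + 1 + ((M.tree 0).findMax 0).time +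
          ((M.tree 1).findMax 0).time + 1 })
    ⟨⟨hM.avl, hM.bst, hM.mem_iff⟩, hP.of_log_eq rfl (by
      have := hR 0
      have := hR 1
      dsimp only
      omega), [], by simp [Machine.outputs], Enumerates.nil_of_const hconst⟩ hpos
  exact ⟨M', (Reaches.of_next hnext).trans h2, h3⟩

/-- Every call is correct, by induction on the length of the suffix. -/
theorem callCorrect (n t₀ s : ℕ) : CallCorrect n t₀ s := by
  induction hd : n - s using Nat.strong_induction_on generalizing s with
  | _ d ih =>
    intro ls M hM hP
    by_cases h0 : suffixCount n M.word s 0 = 0 ∨ suffixCount n M.word s 1 = 0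
    · exact callCorrect_of_zero hM hP ls h0
    by_cases h1 : suffixCount n M.word s 0 = 1 ∧ suffixCount n M.word s 1 = 1
    · exact callCorrect_of_one hM hP ls h1
    · have hsum := suffixCount_add_suffixCount n M.word s
      exact callCorrect_of_ne (fun s' hs' => ih (n - s') (by omega) s' rfl) hM hP ls h0 h1

/-! ### Preprocessing -/

/-- The trees built from the first `k` symbols store their positions. The entries `0` and `[]` of
the machine are irrelevant to its validity. -/
theorem buildTrees_spec {n : ℕ} (u : ℕ → Fin 2) {k : ℕ} (hk : k ≤ n) :
    Machine.Valid k ⟨u, (buildTrees u k).val, 0, []⟩ ∧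
      (buildTrees u k).time ≤ 1 + k * (opTime n + 1) := by
  induction k with
  | zero =>
    refine ⟨⟨fun a => trivial, fun a => Tree.isBST_nil, fun a k => ?_⟩, by simp [buildTrees]⟩
    simp [buildTrees]
  | succ k ih =>
    obtain ⟨⟨h1, h2, h3⟩, h4⟩ := ih (by omega)
    dsimp only at h1 h2 h3
    have hT : ((buildTrees u k).val (u k)).IsPosTree n :=
      ⟨h1 _, h2 _, fun x hx => by have := ((h3 _ x).1 hx).1; omega⟩
    refine ⟨⟨fun a => ?_, fun a => ?_, fun a x => ?_⟩, ?_⟩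
    · by_cases ha : a = u k
      · subst ha
        simpa [buildTrees] using (Tree.isAVL_insert k hT.avl).1
      · simpa [buildTrees, ha] using h1 a
    · by_cases ha : a = u k
      · subst ha
        simpa [buildTrees] using hT.bst.insert k
      · simpa [buildTrees, ha] using h2 a
    · by_cases ha : a = u k
      · subst ha
        simp only [buildTrees, Timed.bind_val, Timed.pure_val, Function.update_self,
          Tree.mem_insert, h3]
        grind
      · simp only [buildTrees, Timed.bind_val, Timed.pure_val, Function.update_of_ne ha, h3]
        grind
    · have := hT.insert_time_le k
      simp only [buildTrees, Timed.bind_time, Timed.tick_time, Timed.pure_time]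
      linarith

/-! ### From words in the array to vertices of the configuration graph -/

/-- The word of length `n` in an array. -/
def restrict (n : ℕ) (u : ℕ → Fin 2) : Word 2 n := fun k => u k

@[simp] theorem restrict_arrayOf {n : ℕ} (w : Word 2 n) : restrict n (arrayOf w) = w := by
  funext k
  simp [restrict, arrayOf]

theorem parikh_restrict (n : ℕ) (u : ℕ → Fin 2) :
    parikh (restrict n u) = suffixCount n u 0 := by
  funext a
  rw [parikh, suffixCount, ← Finset.range_eq_Ico, Finset.card_filter, Finset.card_filter,
    Finset.sum_range (fun k => if u k = a then 1 else 0)]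
  rfl

theorem isTwoSwap_restrict {n : ℕ} {u : ℕ → Fin 2} {p : ℕ × ℕ} (h1 : p.1 < p.2) (h2 : p.2 < n)
    (hne : u p.1 ≠ u p.2) :
    IsTwoSwap (restrict n u) ⟨p.1, h1.trans h2⟩ ⟨p.2, h2⟩ (restrict n (swapWord u p)) := by
  refine ⟨h1, hne, funext fun k => ?_⟩
  simp only [restrict, swapAt, swapWord]
  congr 1
  simp only [Equiv.swap_apply_def, Fin.ext_iff]
  split_ifs <;> rfl

/-- A valid list of 2-swaps is the list of edges of a walk in the configuration graph. -/
theorem exists_walk {n : ℕ} {P : Fin 2 → ℕ} (out : List (ℕ × ℕ)) (w : ParikhWord n P)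
    (u : ℕ → Fin 2) (hw : restrict n u = w.1) (h : SwapsValid n u out) :
    ∃ (v : ParikhWord n P) (p : (configGraph n P).Walk w v),
      p.support.map Subtype.val = (trail u out).map (restrict n) ∧
      List.Forall₂ (fun (d : (configGraph n P).Dart) (s : ℕ × ℕ) =>
        ∃ i j : Fin n, s = ((i : ℕ), (j : ℕ)) ∧ IsTwoSwap d.fst.1 i j d.snd.1) p.darts out := by
  induction out generalizing w u with
  | nil => exact ⟨w, .nil, by simp [trail, hw], by simp⟩
  | cons q out ih =>
    obtain ⟨⟨h1, h2, h3⟩, h4⟩ := h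
    have hswap := isTwoSwap_restrict h1 h2 h3
    have hP : parikh (restrict n (swapWord u q)) = P := by
      rw [← w.2, ← hw, parikh_restrict, parikh_restrict,
        suffixCount_swapWord u (Nat.zero_le _) (h1.trans h2) (Nat.zero_le _) h2]
    obtain ⟨v, p, hp, hd⟩ := ih ⟨_, hP⟩ _ rfl h4
    rw [hw] at hswap
    have hadj : (configGraph n P).Adj w ⟨_, hP⟩ := ⟨_, _, hswap⟩
    refine ⟨v, .cons hadj p, ?_, ?_⟩
    · rw [SimpleGraph.Walk.support_cons, List.map_cons, hp, trail, List.map_cons, hw]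
    · rw [SimpleGraph.Walk.darts_cons]
      exact .cons ⟨_, _, rfl, hswap⟩ hd

theorem Enumerates.isHamiltonianPathFrom {n : ℕ} {P : Fin 2 → ℕ} {w : ParikhWord n P}
    {out : List (ℕ × ℕ)} {v : ℕ → Fin 2} (h : Enumerates n (arrayOf w.1) 0 out v) :
    IsHamiltonianPathFrom w out := by
  obtain ⟨x, p, hp, hd⟩ := exists_walk out w (arrayOf w.1) (restrict_arrayOf w.1) h.valid
  -- the words on the trail agree from position `n` on, so they are determined by their restrictions
  have hinj : ((trail (arrayOf w.1) out).map (restrict n)).Nodup := by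
    refine h.nodup.map_on fun y hy z hz hyz => funext fun k => ?_
    rw [h.mem_iff] at hy hz
    by_cases hk : k < n
    · exact congrFun hyz ⟨k, hk⟩
    · rw [hy.1 k (by omega), hz.1 k (by omega)]
  have hpath : p.IsPath := .mk' (List.Nodup.of_map Subtype.val (hp ▸ hinj))
  refine ⟨x, p, hpath.isHamiltonian_of_mem fun y => ?_, hd⟩
  have hy : arrayOf y.1 ∈ trail (arrayOf w.1) out := by
    rw [h.mem_iff]
    refine ⟨fun k hk => ?_, ?_⟩
    · have : ¬ k < n := by omega
      simp [arrayOf, this]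
    · rw [← parikh_restrict, ← parikh_restrict, restrict_arrayOf, restrict_arrayOf, y.2, w.2]
  have := List.mem_map_of_mem (f := restrict n) hy
  rw [restrict_arrayOf, ← hp] at this
  obtain ⟨z, hz, hzy⟩ := List.mem_map.1 this
  rwa [← Subtype.ext hzy]

/-! ### Logarithmic bounds -/

theorem heightBound_le {n : ℕ} (hn : 2 ≤ n) : (heightBound n : ℝ) ≤ 8 * Real.log n := by
  have hn' : (2 : ℝ) ≤ n := by exact_mod_cast hn
  have h1 : (2 : ℝ) ^ heightBound n ≤ ((n : ℝ) + 1) ^ 2 := by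
    exact_mod_cast Nat.pow_log_le_self 2 (by positivity : (n + 1) ^ 2 ≠ 0)
  have h2 : ((n : ℝ) + 1) ^ 2 ≤ (n : ℝ) ^ 4 := by
    have : (n : ℝ) + 1 ≤ (n : ℝ) ^ 2 := by nlinarith
    calc ((n : ℝ) + 1) ^ 2 ≤ ((n : ℝ) ^ 2) ^ 2 := by gcongr
      _ = (n : ℝ) ^ 4 := by ring
  have h3 := Real.log_le_log (by positivity) (h1.trans h2)
  rw [Real.log_pow, Real.log_pow] at h3
  have h4 : (1 / 2 : ℝ) ≤ Real.log 2 := by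
    have := Real.log_two_gt_d9
    linarith
  have h5 : (0 : ℝ) ≤ heightBound n := by positivity
  push_cast at h3
  nlinarith

theorem one_le_two_mul_log {n : ℕ} (hn : 2 ≤ n) : 1 ≤ 2 * Real.log n := by
  have h1 : Real.log 2 ≤ Real.log n := Real.log_le_log (by norm_num) (by exact_mod_cast hn)
  have h2 := Real.log_two_gt_d9
  linarith

theorem opTime_le {n : ℕ} (hn : 2 ≤ n) : (opTime n : ℝ) ≤ 44 * Real.log n := by
  have := heightBound_le hn
  have := one_le_two_mul_log hn
  rw [opTime]
  push_cast
  linarith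

theorem maxDelay_le {n : ℕ} (hn : 2 ≤ n) : (maxDelay n : ℝ) ≤ 480 * Real.log n := by
  have := opTime_le hn
  have := one_le_two_mul_log hn
  rw [maxDelay]
  push_cast
  linarith

theorem preprocessingTime_le {n : ℕ} (hn : 2 ≤ n) (w : Word 2 n) :
    (preprocessingTime w : ℝ) ≤ 480 * (n * Real.log n) := by
  have h1 : (preprocessingTime w : ℝ) ≤ 1 + n * (opTime n + 1) := by
    exact_mod_cast (buildTrees_spec (arrayOf w) le_rfl).2
  have h2 := opTime_le hn
  have h3 := one_le_two_mul_log hn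
  have h4 : (1 : ℝ) ≤ n := by exact_mod_cast (by omega : 1 ≤ n)
  have h5 : (n : ℝ) * (opTime n + 1) ≤ n * (46 * Real.log n) := by
    gcongr
    linarith
  nlinarith

theorem Machine.Paced.delayAtMost {n t₀ : ℕ} {M : Machine} (h : M.Paced n t₀ 0) {D : ℝ}
    (hD : (maxDelay n : ℝ) ≤ D) : DelayAtMost M t₀ D := by
  refine List.IsChain.imp (fun s t hst => ?_) h
  have : (t : ℝ) ≤ s + maxDelay n := by exact_mod_cast hst
  linarith

/-- The run halts, because the first call returns to the null pointer. -/
theorem exists_haltsWith {n : ℕ} (w : Word 2 n) :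
    ∃ M : Machine, HaltsWith w M ∧ M.Paced n (preprocessingTime w) 0 ∧
      ∃ v, Enumerates n (arrayOf w) 0 M.outputs v := by
  have hcall := callCorrect n (preprocessingTime w) 0 [] (start w).2
  have hV := (buildTrees_spec (arrayOf w) (le_refl n)).1
  obtain ⟨M', ⟨k, hk⟩, hp⟩ := hcall ⟨hV.avl, hV.bst, hV.mem_iff⟩ (by
    simp only [Machine.Paced, Machine.outputTimes, start, List.map_nil, List.cons_append,
      List.nil_append, List.isChain_cons_cons, List.isChain_singleton, and_true, maxDelay]
    omega)
  refine ⟨{ M' with clock := M'.clock + 1 }, ⟨k, ?_⟩, hp.paced.of_log_eq rfl (by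
    dsimp only; omega), ?_⟩
  · have hs : start w = (.call (suffixCount n (start w).2.word 0) [], (start w).2) := by
      rw [← parikh_restrict]
      simp [start]
    rw [← hs] at hk
    exact hk
  · obtain ⟨out, h1, h2⟩ := hp.enumerates
    refine ⟨M'.word, ?_⟩
    have : M'.outputs = out := by simpa [start, Machine.outputs] using h1
    exact this ▸ h2

end TwoSwap

theorem mainTheorem4 :
    ∃ C : ℝ, ∀ (P₁ P₂ n : ℕ), P₁ + P₂ = n → ∀ w : TwoSwap.ParikhWord n ![P₁, P₂],
      ∃ M : TwoSwap.Machine, TwoSwap.HaltsWith w.1 M ∧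
        TwoSwap.IsHamiltonianPathFrom w M.outputs ∧
        (2 ≤ n →
          (TwoSwap.preprocessingTime w.1 : ℝ) ≤ C * (n * Real.log n) ∧
          TwoSwap.DelayAtMost M (TwoSwap.preprocessingTime w.1) (C * Real.log n)) := by
  refine ⟨480, fun P₁ P₂ n _ w => ?_⟩
  obtain ⟨M, h1, h2, v, h3⟩ := TwoSwap.exists_haltsWith w.1
  exact ⟨M, h1, h3.isHamiltonianPathFrom, fun hn =>
    ⟨TwoSwap.preprocessingTime_le hn w.1, h2.delayAtMost (TwoSwap.maxDelay_le hn)⟩⟩
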